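/- Let $M$ be a smooth $3$-manifold with a para-CR structure, that is, two smooth direction fields (smooth rank-one subbundles) $X, Y\subset TM$ that are linearly independent at every point. Then $M$ can be locally embedded as a hypersurface of $\mathbb R^2_{xy}\times\mathbb R^2_{ab}$ so that the induced para-CR structure is the original one: for every $p\in M$ there are an open neighbourhood $U$ of $p$, an open neighbourhood $V$ of $0$ in $\mathbb R^3$, a smooth function $\phi\colon V\to\mathbb R$ with $\frac{\partial\phi}{\partial a}(0)=0$, and a smooth embedding $f\colon U\to\mathbb R^2_{xy}\times\mathbb R^2_{ab}$ with $f(p)=0$ whose image is the hypersurface $$S=\{(x,y,a,b) : (a,b,x)\in V,\ y=a+\phi(a,b,x)\},$$ such that for every $q\in U$ $$df_q(X_q)=T_{f(q)}S\cap T\mathbb R^2_{xy},\qquad df_q(Y_q)=T_{f(q)}S\cap T\mathbb R^2_{ab}.$$ -/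

import Mathlib

open scoped Manifold ContDiff Topology

attribute [-instance] TopCat.of.chartedSpace

noncomputable section

/-- The product `ℝ²_xy × ℝ²_ab`; a point is written `((x, y), (a, b))`. -/
abbrev Ambient : Type := (ℝ × ℝ) × (ℝ × ℝ)

/-- The tangent space of the factor `ℝ²_xy`. -/
def tangentXY : Submodule ℝ Ambient := Submodule.prod ⊤ ⊥

/-- The tangent space of the factor `ℝ²_ab`. -/
def tangentAB : Submodule ℝ Ambient := Submodule.prod ⊥ ⊤

/-- The hypersurface `y = a + φ(a, b, x)` over the set `V` of parameters `(a, b, x)`. -/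
def hypersurface (V : Set (ℝ × ℝ × ℝ)) (φ : ℝ × ℝ × ℝ → ℝ) : Set Ambient :=
  {P | ∃ x y a b : ℝ, P = ((x, y), (a, b)) ∧ (a, b, x) ∈ V ∧ y = a + φ (a, b, x)}

section

variable {M : Type*} [TopologicalSpace M] [ChartedSpace (EuclideanSpace ℝ (Fin 3)) M]
  [IsManifold (𝓡 3) ∞ M]

/-- A smooth direction field (line field) on a 3-manifold: a family of subspaces of the tangent
spaces which is spanned, near every point, by a smooth nowhere vanishing vector field. -/
def IsDirectionField (D : ∀ q : M, Submodule ℝ (TangentSpace (𝓡 3) q)) : Prop :=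
  ∀ p : M, ∃ (U : Set M) (Z : ∀ q : M, TangentSpace (𝓡 3) q), IsOpen U ∧ p ∈ U ∧
    ContMDiffOn (𝓡 3) (𝓡 3).tangent ∞ (fun q => (⟨q, Z q⟩ : TangentBundle (𝓡 3) M)) U ∧
    ∀ q ∈ U, Z q ≠ 0 ∧ D q = Submodule.span ℝ {Z q}

/-- A para-CR structure on a 3-manifold: two direction fields, linearly independent at
every point. -/
structure IsParaCRStructure (X Y : ∀ q : M, Submodule ℝ (TangentSpace (𝓡 3) q)) : Prop where
  left : IsDirectionField X
  right : IsDirectionField Y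
  independent : ∀ q : M, X q ⊓ Y q = ⊥

/-- The differential at `q` of a map into `ℝ²_xy × ℝ²_ab`. -/
def ambientDifferential (f : M → Ambient) (q : M) : TangentSpace (𝓡 3) q →ₗ[ℝ] Ambient :=
  (mfderiv (𝓡 3) 𝓘(ℝ, Ambient) f q).toLinearMap

/-- `f` restricts to a smooth embedding of the open set `U`: a smooth immersion which is
a homeomorphism onto its image. -/
structure IsSmoothEmbeddingOn (f : M → Ambient) (U : Set M) : Prop where
  smooth : ContMDiffOn (𝓡 3) 𝓘(ℝ, Ambient) ∞ f U
  immersion : ∀ q ∈ U, Function.Injective (ambientDifferential f q)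
  embedding : Topology.IsEmbedding (U.domRestrict f)

/-- The tangent space at `f q` of the image of an embedding `f`, as a subspace
of `ℝ²_xy × ℝ²_ab`. -/
def imageTangent (f : M → Ambient) (q : M) : Submodule ℝ Ambient :=
  LinearMap.range (ambientDifferential f q)

end

end

/-!
A vector field on a 3-manifold that does not vanish at `p` has, near `p`, two independent first
integrals, and the common kernel of their differentials is the line field it spans. Let `a`, `b` be
first integrals of `X`, let `x`, `y` be first integrals of `Y`, and put `f = ((x, y), (a, b))`. The
differential of `f` sends a vector into `T ℝ²_xy` exactly when it kills `da` and `db`, that is, when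
the vector lies in `X`; in the same way `Y` corresponds to `T ℝ²_ab`. As `X ∩ Y = 0`, the map `f`
is an immersion (`injective_and_map_eq_of_ker_components`).

The differentials at `p` of the first integrals can be prescribed. Complete spanning vectors of `X`
and `Y` at `p` to a basis, with dual basis `ξ, η, ζ`, and require `dx = ξ`, `db = η`, `da = dy = ζ`. Then
`(a, b, x)` is a coordinate system, and expressing `y - a` in it yields a function `φ` with
`dφ(0) = 0` whose graph is the image of `f` (`exists_adapted_functions`).

First integrals come from a straightening of the vector field (`exists_straightening`), hence from
a local flow that is smooth in time and initial value jointly (`exists_smooth_local_flow`). The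
latter is an application of the inverse function theorem on the Banach space `C([-1, 1], E)` to
the integral equation `γ = x + s ∫ X ∘ γ`; the equation is smooth in `γ` because composition with a
smooth map is a smooth operator on spaces of continuous curves (`contDiff_continuousMap_comp`).
-/

/-! ### Smooth inverse function theorem -/

/-- The inverse function theorem with a neighbourhood on which all derivatives are invertible, so
that the inverse is smooth on its whole domain. -/
theorem exists_openPartialHomeomorph_contDiffOn {E F : Type*}
    [NormedAddCommGroup E] [NormedSpace ℝ E] [CompleteSpace E]
    [NormedAddCommGroup F] [NormedSpace ℝ F]
    {g : E → F} {O : Set E} {u₀ : E} {g' : E ≃L[ℝ] F} (hO : IsOpen O) (hu₀ : u₀ ∈ O)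
    (hg : ContDiffOn ℝ ∞ g O) (hg' : HasFDerivAt g (g' : E →L[ℝ] F) u₀) :
    ∃ e : OpenPartialHomeomorph E F, u₀ ∈ e.source ∧ e.source ⊆ O ∧ (e : E → F) = g ∧
      ContDiffOn ℝ ∞ e.symm e.target ∧
      ∀ u ∈ e.source, ∃ A : E ≃L[ℝ] F, HasFDerivAt g (A : E →L[ℝ] F) u := by
  have hat : ContDiffAt ℝ ∞ g u₀ := hg.contDiffAt (hO.mem_nhds hu₀)
  have hn : (∞ : WithTop ℕ∞) ≠ 0 := by simp
  set e := ContDiffAt.toOpenPartialHomeomorph g hat hg' hn with he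
  have hcoe : (e : E → F) = g := ContDiffAt.toOpenPartialHomeomorph_coe hat hg' hn
  have hmem : u₀ ∈ e.source := ContDiffAt.mem_toOpenPartialHomeomorph_source hat hg' hn
  have hcont : ContinuousOn (fderiv ℝ g) O :=
    hg.continuousOn_fderiv_of_isOpen hO (by simp)
  set W := O ∩ fderiv ℝ g ⁻¹' Set.range ContinuousLinearEquiv.toContinuousLinearMap with hW
  have hWo : IsOpen W := hcont.isOpen_inter_preimage hO ContinuousLinearEquiv.isOpen
  have hsrc : (e.restrOpen W hWo).source = e.source ∩ W := e.restrOpen_source W hWo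
  have hder : ∀ u ∈ W, ∃ A : E ≃L[ℝ] F, HasFDerivAt g (A : E →L[ℝ] F) u := by
    rintro u ⟨huO, A, hA⟩
    exact ⟨A, hA ▸ ((hg.contDiffAt (hO.mem_nhds huO)).differentiableAt hn).hasFDerivAt⟩
  refine ⟨e.restrOpen W hWo, ?_, ?_, hcoe, ?_, ?_⟩
  · rw [hsrc]; exact ⟨hmem, hu₀, g', hg'.fderiv.symm⟩
  · rw [hsrc]; exact fun u hu => hu.2.1
  · intro v hv
    have hu := (e.restrOpen W hWo).map_target hv
    rw [hsrc] at hu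
    obtain ⟨A, hA⟩ := hder _ hu.2
    refine ((e.restrOpen W hWo).contDiffAt_symm hv (f₀' := A) ?_ ?_).contDiffWithinAt
    · exact hcoe ▸ hA
    · exact hcoe ▸ hg.contDiffAt (hO.mem_nhds hu.2.1)
  · intro u hu
    rw [hsrc] at hu
    exact hder u hu.2

/-! ### Smoothness of composition operators on spaces of continuous maps -/

section Composition

variable {K : Type*} [TopologicalSpace K] [CompactSpace K]
  {E F : Type*} [NormedAddCommGroup E] [NormedSpace ℝ E]
  [NormedAddCommGroup F] [NormedSpace ℝ F]

/-- Pointwise application of a continuous family of operators to a continuous curve, as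
a bounded bilinear map. -/
noncomputable def pointwiseApply : C(K, E →L[ℝ] F) →L[ℝ] C(K, E) →L[ℝ] C(K, F) :=
  LinearMap.mkContinuous₂
    (LinearMap.mk₂ ℝ (fun (A : C(K, E →L[ℝ] F)) (h : C(K, E)) =>
        (⟨fun t => A t (h t), A.continuous.clm_apply h.continuous⟩ : C(K, F)))
      (fun _ _ _ => by ext; simp) (fun _ _ _ => by ext; simp)
      (fun _ _ _ => by ext; simp) (fun _ _ _ => by ext; simp))
    1 fun A h => by
      rw [one_mul, ContinuousMap.norm_le _ (by positivity)]
      intro t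
      exact ((A t).le_opNorm (h t)).trans
        (mul_le_mul (A.norm_coe_le_norm t) (h.norm_coe_le_norm t) (norm_nonneg _) (by positivity))

@[simp]
theorem pointwiseApply_apply (A : C(K, E →L[ℝ] F)) (h : C(K, E)) (t : K) :
    pointwiseApply A h t = A t (h t) := rfl

/-- The composition operator `γ ↦ G ∘ γ` is differentiable: on the compact range of `γ` the
continuity of the derivative of `G` is uniform, so the first order expansion of `G` holds uniformly
along `γ`. -/
theorem hasFDerivAt_continuousMap_comp {G : E → F} {G' : E → E →L[ℝ] F}
    (hG : Continuous G) (hG' : Continuous G') (h : ∀ x, HasFDerivAt G (G' x) x) (γ : C(K, E)) :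
    HasFDerivAt (fun η : C(K, E) => (⟨G, hG⟩ : C(E, F)).comp η)
      (pointwiseApply ((⟨G', hG'⟩ : C(E, E →L[ℝ] F)).comp γ)) γ := by
  rw [hasFDerivAt_iff_isLittleO_nhds_zero, Asymptotics.isLittleO_iff]
  intro ε hε
  have hu := (isCompact_range γ.continuous).uniformContinuousAt_of_continuousAt G'
    (fun a _ => hG'.continuousAt) (Metric.dist_mem_uniformity hε)
  obtain ⟨δ, hδ, hδu⟩ := Metric.mem_uniformity_dist.1 hu
  filter_upwards [Metric.ball_mem_nhds (0 : C(K, E)) hδ] with η hη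
  rw [ContinuousMap.norm_le _ (by positivity)]
  intro t
  have key := (convex_ball (γ t) δ).norm_image_sub_le_of_norm_hasFDerivWithin_le'
    (f := G) (f' := G') (φ := G' (γ t)) (C := ε) (x := γ t) (y := γ t + η t)
    (fun x _ => (h x).hasFDerivWithinAt)
    (fun x hx => by
      rw [← dist_eq_norm, dist_comm]
      exact (hδu (by rwa [dist_comm]) ⟨t, rfl⟩ : dist _ _ < ε).le)
    (Metric.mem_ball_self hδ)
    (by
      rw [mem_ball_iff_norm, add_sub_cancel_left]
      exact (η.norm_coe_le_norm t).trans_lt (by simpa using hη))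
  rw [add_sub_cancel_left] at key
  exact key.trans (mul_le_mul_of_nonneg_left (η.norm_coe_le_norm t) hε.le)

end Composition

universe u in
theorem contDiff_nat_continuousMap_comp {K : Type*} [TopologicalSpace K] [CompactSpace K]
    {E : Type u} [NormedAddCommGroup E] [NormedSpace ℝ E](n : ℕ) :
    ∀ {F : Type u} [NormedAddCommGroup F] [NormedSpace ℝ F] (G : C(E, F)), ContDiff ℝ ∞ G →
      ContDiff ℝ n (fun η : C(K, E) => G.comp η) := by
  induction n with
  | zero =>
    intro F _ _ G _
    exact contDiff_zero.2 G.continuous_postcomp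
  | succ n ih =>
    intro F _ _ G hG
    have hG' : ContDiff ℝ ∞ (fderiv ℝ G) := hG.fderiv_right (by simp)
    push_cast
    refine contDiff_succ_iff_hasFDerivAt.2 ⟨_, ?_, fun γ => hasFDerivAt_continuousMap_comp
      G.continuous hG'.continuous (fun x => (hG.differentiable (by simp) x).hasFDerivAt) γ⟩
    exact pointwiseApply.contDiff.comp (ih ⟨fderiv ℝ G, hG'.continuous⟩ hG')

universe u in
/-- The composition operator `γ ↦ G ∘ γ` of a smooth map `G` is smooth. -/
theorem contDiff_continuousMap_comp {K : Type*} [TopologicalSpace K] [CompactSpace K]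
    {E : Type u} [NormedAddCommGroup E] [NormedSpace ℝ E]
    {F : Type u} [NormedAddCommGroup F] [NormedSpace ℝ F] (G : C(E, F)) (hG : ContDiff ℝ ∞ G) :
    ContDiff ℝ ∞ (fun η : C(K, E) => G.comp η) :=
  contDiff_infty.2 fun n => contDiff_nat_continuousMap_comp n G hG

/-! ### Smooth local flows of vector fields -/

section Flow

variable {E : Type*} [NormedAddCommGroup E] [NormedSpace ℝ E]

/-- Integration from `0` on the interval `[-1, 1]`, as a bounded operator on continuous curves. -/
noncomputable def primitiveCLM :
    C(Set.Icc (-1 : ℝ) 1, E) →L[ℝ] C(Set.Icc (-1 : ℝ) 1, E) :=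
  LinearMap.mkContinuous
    { toFun := fun γ =>
        ⟨fun t => ∫ τ in (0 : ℝ)..t, Set.IccExtend (by norm_num : (-1 : ℝ) ≤ 1) γ τ,
          (intervalIntegral.continuous_primitive
            (fun _ _ => (γ.continuous.Icc_extend').intervalIntegrable _ _) 0).comp
            continuous_subtype_val⟩
      map_add' := fun γ η => by
        ext t
        exact intervalIntegral.integral_add ((γ.continuous.Icc_extend').intervalIntegrable _ _)
          ((η.continuous.Icc_extend').intervalIntegrable _ _)
      map_smul' := fun c γ => by
        ext t
        exact intervalIntegral.integral_smul c _ }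
    1 fun γ => by
      rw [one_mul, ContinuousMap.norm_le _ (norm_nonneg _)]
      intro t
      refine (intervalIntegral.norm_integral_le_of_norm_le_const (C := ‖γ‖)
        fun τ _ => γ.norm_coe_le_norm _).trans ?_
      rw [sub_zero]
      exact mul_le_of_le_one_right (norm_nonneg _) (abs_le.2 t.2)

theorem primitiveCLM_apply (γ : C(Set.Icc (-1 : ℝ) 1, E)) (t : Set.Icc (-1 : ℝ) 1) :
    primitiveCLM γ t =
      ∫ τ in (0 : ℝ)..t, Set.IccExtend (by norm_num : (-1 : ℝ) ≤ 1) γ τ := rfl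

/-- Multiplication by `c` as a self-map of `[-1, 1]`, for `|c| ≤ 1`. -/
def rescale (c : ℝ) (hc : |c| ≤ 1) : C(Set.Icc (-1 : ℝ) 1, Set.Icc (-1 : ℝ) 1) :=
  ⟨fun t => ⟨c * t, abs_le.1 (by
    rw [abs_mul]; exact mul_le_one₀ hc (abs_nonneg _) (abs_le.2 t.2))⟩, by fun_prop⟩

@[simp]
theorem rescale_apply_coe (c : ℝ) (hc : |c| ≤ 1) (t : Set.Icc (-1 : ℝ) 1) :
    (rescale c hc t : ℝ) = c * t := rfl

theorem smul_primitiveCLM_comp_rescale (γ : C(Set.Icc (-1 : ℝ) 1, E)) (c : ℝ) (hc : |c| ≤ 1)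
    (t : Set.Icc (-1 : ℝ) 1) :
    c • primitiveCLM (γ.comp (rescale c hc)) t = primitiveCLM γ (rescale c hc t) := by
  rw [primitiveCLM_apply, primitiveCLM_apply, rescale_apply_coe]
  have h := intervalIntegral.smul_integral_comp_mul_left (a := (0 : ℝ)) (b := t)
    (Set.IccExtend (by norm_num : (-1 : ℝ) ≤ 1) γ) c
  rw [mul_zero] at h
  rw [← h]
  congr 1
  refine intervalIntegral.integral_congr fun τ hτ => ?_
  have hτ' : τ ∈ Set.Icc (-1 : ℝ) 1 :=
    (Set.uIcc_subset_Icc (by norm_num) t.2) hτ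
  simp only [Set.IccExtend_of_mem _ _ hτ', ContinuousMap.comp_apply]
  exact (Set.IccExtend_of_mem _ γ (rescale c hc ⟨τ, hτ'⟩).2).symm

/-- The operator `(s, γ) ↦ (s, γ - s ∫ X ∘ γ)`. A curve `γ` on `[-1, 1]` solves `γ' = s X(γ)`,
`γ 0 = x` exactly when this operator sends `(s, γ)` to `(s, x)`, the constant curve `x`. -/
noncomputable def integralOperator (X : C(E, E)) (p : ℝ × C(Set.Icc (-1 : ℝ) 1, E)) :
    ℝ × C(Set.Icc (-1 : ℝ) 1, E) :=
  (p.1, p.2 - p.1 • primitiveCLM (X.comp p.2))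

theorem contDiff_integralOperator (X : C(E, E)) (hX : ContDiff ℝ ∞ X) :
    ContDiff ℝ ∞ (integralOperator X) :=
  contDiff_fst.prodMk (contDiff_snd.sub (contDiff_fst.smul
    (primitiveCLM.contDiff.comp ((contDiff_continuousMap_comp X hX).comp contDiff_snd))))

theorem hasFDerivAt_integralOperator (X : C(E, E)) (hX : ContDiff ℝ ∞ X)
    (γ : C(Set.Icc (-1 : ℝ) 1, E)) :
    ∃ A : (ℝ × C(Set.Icc (-1 : ℝ) 1, E)) ≃L[ℝ] ℝ × C(Set.Icc (-1 : ℝ) 1, E),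
      HasFDerivAt (integralOperator X)
        (A : (ℝ × C(Set.Icc (-1 : ℝ) 1, E)) →L[ℝ] ℝ × C(Set.Icc (-1 : ℝ) 1, E)) (0, γ) := by
  have hQ : ContDiff ℝ ∞
      (fun p : ℝ × C(Set.Icc (-1 : ℝ) 1, E) => primitiveCLM (X.comp p.2)) :=
    primitiveCLM.contDiff.comp ((contDiff_continuousMap_comp X hX).comp contDiff_snd)
  have hQ' := ((hQ.differentiable (by simp)) (0, γ)).hasFDerivAt
  have hfst : HasFDerivAt (Prod.fst : ℝ × C(Set.Icc (-1 : ℝ) 1, E) → ℝ) _ (0, γ) :=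
    hasFDerivAt_fst (𝕜 := ℝ)
  have hsnd : HasFDerivAt (Prod.snd : ℝ × C(Set.Icc (-1 : ℝ) 1, E) → C(Set.Icc (-1 : ℝ) 1, E))
      _ (0, γ) := hasFDerivAt_snd (𝕜 := ℝ)
  refine ⟨(ContinuousLinearEquiv.refl ℝ ℝ).skewProd (ContinuousLinearEquiv.refl ℝ _)
    (ContinuousLinearMap.toSpanSingleton ℝ (-primitiveCLM (X.comp γ))), ?_⟩
  refine (hfst.prodMk (hsnd.sub (hfst.smul hQ'))).congr_fderiv ?_
  ext p t <;> simp [sub_eq_add_neg]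

/-- Local flows of smooth vector fields depend smoothly on time and initial value together.
The curves `t ↦ φ (x, s t)` on `[-1, 1]` are produced by the inverse function theorem for
`integralOperator`, so they depend smoothly on `(x, s)`; local injectivity of the operator
identifies the curve for `c s` with the rescaled curve for `s`, and this gives the differential
equation. -/
theorem exists_smooth_local_flow [CompleteSpace E] {X : E → E} (hX : ContDiff ℝ ∞ X) (u₀ : E) :
    ∃ δ > 0, ∃ φ : E × ℝ → E,
      ContDiffOn ℝ ∞ φ (Metric.ball u₀ δ ×ˢ Metric.ball 0 δ) ∧
      (∀ x ∈ Metric.ball u₀ δ, φ (x, 0) = x) ∧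
      ∀ x ∈ Metric.ball u₀ δ, ∀ s ∈ Metric.ball (0 : ℝ) δ,
        HasDerivAt (fun s' => φ (x, s')) (X (φ (x, s))) s := by
  let K := Set.Icc (-1 : ℝ) 1
  let Xc : C(E, E) := ⟨X, hX.continuous⟩
  let one : K := ⟨1, by norm_num [K]⟩
  let const : E →L[ℝ] C(K, E) := ContinuousLinearMap.const ℝ K
  obtain ⟨A, hA⟩ := hasFDerivAt_integralOperator Xc hX (const u₀)
  obtain ⟨e, he₀, -, hecoe, hesymm, -⟩ := exists_openPartialHomeomorph_contDiffOn isOpen_univ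
    (Set.mem_univ _) (contDiff_integralOperator Xc hX).contDiffOn hA
  have hHzero : ∀ γ, integralOperator Xc (0, γ) = (0, γ) := fun γ => by simp [integralOperator]
  -- the inverse image of the data `(s, x)`
  let j : E × ℝ → ℝ × C(K, E) := fun p => (p.2, const p.1)
  have hj : ContDiff ℝ ∞ j := contDiff_snd.prodMk (const.contDiff.comp contDiff_fst)
  let Γ : E × ℝ → C(K, E) := fun p => (e.symm (j p)).2
  have hj₀ : j (u₀, 0) ∈ e.target := by
    have := e.map_source he₀
    rwa [hecoe, hHzero] at this
  have hΓ₀ : Γ (u₀, 0) = const u₀ := by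
    have := e.left_inv he₀
    rw [hecoe, hHzero] at this
    exact congrArg Prod.snd this
  have hΓfst : ∀ p, j p ∈ e.target → e.symm (j p) = (p.2, Γ p) := fun p hp => by
    have := e.right_inv hp
    rw [hecoe] at this
    exact Prod.ext (congrArg Prod.fst this :) rfl
  have hΓeq : ∀ p, j p ∈ e.target → ∀ t, Γ p t = p.1 + p.2 • primitiveCLM (Xc.comp (Γ p)) t := by
    intro p hp t
    have h := e.right_inv hp
    rw [hΓfst p hp, hecoe] at h
    have h' := congrArg (fun q : ℝ × C(K, E) => q.2 t) h
    simpa [integralOperator, j, const, sub_eq_iff_eq_add] using h'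
  have hTopen : IsOpen (j ⁻¹' e.target) := e.open_target.preimage hj.continuous
  have hΓsm : ContDiffOn ℝ ∞ Γ (j ⁻¹' e.target) :=
    contDiff_snd.comp_contDiffOn (hesymm.comp hj.contDiffOn fun _ h => h)
  obtain ⟨ε, hε, hεs⟩ := Metric.isOpen_iff.1 e.open_source _ he₀
  have hnear : ∀ᶠ p in 𝓝 (u₀, (0 : ℝ)), j p ∈ e.target ∧ Γ p ∈ Metric.ball (const u₀) ε :=
    Filter.Eventually.and (hTopen.mem_nhds hj₀) <|
      (hΓsm.continuousOn.continuousAt (hTopen.mem_nhds hj₀)).preimage_mem_nhds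
        (by rw [hΓ₀]; exact Metric.ball_mem_nhds _ hε)
  obtain ⟨δ', hδ', hδ's⟩ := Metric.eventually_nhds_iff_ball.1 hnear
  have hmem : ∀ x ∈ Metric.ball u₀ (min δ' ε), ∀ s ∈ Metric.ball (0 : ℝ) (min δ' ε),
      (x, s) ∈ Metric.ball (u₀, (0 : ℝ)) δ' := fun x hx s hs => by
    rw [← ball_prod_same]
    exact ⟨Metric.ball_subset_ball (min_le_left _ _) hx,
      Metric.ball_subset_ball (min_le_left _ _) hs⟩
  have hscale : ∀ x ∈ Metric.ball u₀ (min δ' ε), ∀ s ∈ Metric.ball (0 : ℝ) (min δ' ε),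
      ∀ (c : ℝ) (hc : |c| ≤ 1), Γ (x, c * s) = (Γ (x, s)).comp (rescale c hc) := by
    intro x hx s hs c hc
    obtain ⟨htar, hball⟩ := hδ's _ (hmem x hx s hs)
    have hcs : c * s ∈ Metric.ball (0 : ℝ) (min δ' ε) := by
      rw [mem_ball_zero_iff, Real.norm_eq_abs] at hs ⊢
      rw [abs_mul]
      exact (mul_le_of_le_one_left (abs_nonneg _) hc).trans_lt hs
    have hsource : (c * s, (Γ (x, s)).comp (rescale c hc)) ∈ e.source := by
      refine hεs ?_
      rw [← ball_prod_same]
      refine ⟨Metric.ball_subset_ball (min_le_right _ _) hcs, ?_⟩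
      rw [Metric.mem_ball] at hball ⊢
      refine lt_of_le_of_lt ?_ hball
      rw [ContinuousMap.dist_le dist_nonneg]
      exact fun t => ContinuousMap.dist_apply_le_dist (f := Γ (x, s)) (g := const u₀)
        (rescale c hc t)
    have himage : e (c * s, (Γ (x, s)).comp (rescale c hc)) = j (x, c * s) := by
      rw [hecoe]
      refine Prod.ext rfl (ContinuousMap.ext fun t => ?_)
      have h1 := smul_primitiveCLM_comp_rescale (Xc.comp (Γ (x, s))) c hc t
      have h2 := hΓeq _ htar (rescale c hc t)
      have h3 : (c * s) • primitiveCLM (Xc.comp ((Γ (x, s)).comp (rescale c hc))) t =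
          s • primitiveCLM (Xc.comp (Γ (x, s))) (rescale c hc t) := by
        rw [← h1, smul_smul, mul_comm]; rfl
      change Γ (x, s) (rescale c hc t) -
        (c * s) • primitiveCLM (Xc.comp ((Γ (x, s)).comp (rescale c hc))) t = x
      rw [h3, h2, add_sub_cancel_right]
    have := e.left_inv hsource
    rw [himage] at this
    exact congrArg Prod.snd this
  refine ⟨min δ' ε, lt_min hδ' hε, fun p => Γ p one, ?_, ?_, ?_⟩
  · exact (ContinuousMap.evalCLM ℝ one).contDiff.comp_contDiffOn
      (hΓsm.mono fun p (hp : p ∈ Metric.ball _ _ ×ˢ Metric.ball _ _) =>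
        (hδ's _ (hmem _ hp.1 _ hp.2)).1)
  · intro x hx
    have := hΓeq (x, 0) (hδ's _ (hmem _ hx _ (Metric.mem_ball_self (lt_min hδ' hε)))).1 one
    simpa using this
  · intro x hx s hs
    -- a time `r` beyond `s`, so that `s` is an interior time of the curve `Γ (x, r)`
    obtain ⟨r, hsr, hr⟩ := exists_between (mem_ball_zero_iff.1 hs)
    rw [Real.norm_eq_abs] at hsr
    have hr0 : 0 < r := (abs_nonneg s).trans_lt hsr
    have hrball : r ∈ Metric.ball (0 : ℝ) (min δ' ε) := by
      rwa [mem_ball_zero_iff, Real.norm_of_nonneg hr0.le]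
    have htar := (hδ's _ (hmem x hx r hrball)).1
    let c : ℝ → E := Set.IccExtend (by norm_num : (-1 : ℝ) ≤ 1) (Xc.comp (Γ (x, r)))
    have hc : Continuous c := (Xc.comp (Γ (x, r))).continuous.Icc_extend'
    have hle : ∀ s', |s'| < r → |s' / r| ≤ 1 := fun s' h => by
      rw [abs_div, abs_of_pos hr0]; exact (div_lt_one hr0).2 h |>.le
    have hcurve : ∀ s' (h : |s'| < r), Γ (x, s') one = Γ (x, r) ⟨s' / r, abs_le.1 (hle s' h)⟩ := by
      intro s' h
      have := hscale x hx r hrball (s' / r) (hle s' h)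
      rw [div_mul_cancel₀ _ hr0.ne'] at this
      rw [this]
      exact congrArg (Γ (x, r)) (Subtype.ext (mul_one _))
    have hform : ∀ s', |s'| < r → Γ (x, s') one = x + r • ∫ τ in (0 : ℝ)..(s' / r), c τ :=
      fun s' h => by rw [hcurve s' h]; exact hΓeq _ htar _
    have hprim : HasDerivAt (fun u => ∫ τ in (0 : ℝ)..u, c τ) (c (s / r)) (s / r) :=
      (hc.integral_hasStrictDerivAt 0 (s / r)).hasDerivAt
    have hcomp : HasDerivAt (fun s' => ∫ τ in (0 : ℝ)..(s' / r), c τ) ((1 / r) • c (s / r)) s :=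
      HasDerivAt.scomp (g₁ := fun u => ∫ τ in (0 : ℝ)..u, c τ) (h := fun s' => s' / r) s hprim
        ((hasDerivAt_id s).div_const r)
    have hd : HasDerivAt (fun s' => x + r • ∫ τ in (0 : ℝ)..(s' / r), c τ)
        (r • ((1 / r) • c (s / r))) s :=
      (hcomp.const_smul r).const_add x
    have hval : r • ((1 / r) • c (s / r)) = X (Γ (x, s) one) := by
      rw [smul_smul, mul_one_div_cancel hr0.ne', one_smul, hcurve s hsr]
      exact Set.IccExtend_of_mem _ _ (abs_le.1 (hle s hsr))
    rw [← hval]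
    refine hd.congr_of_eventuallyEq ?_
    filter_upwards [(isOpen_lt continuous_abs continuous_const).mem_nhds hsr] with s' hs'
    exact hform s' hs'

end Flow

/-! ### Straightening of vector fields -/

section Straightening

variable {E : Type*} [NormedAddCommGroup E] [NormedSpace ℝ E] [FiniteDimensional ℝ E]

/-- The germ of a smooth function extends to a globally smooth function, by a bump function. -/
theorem exists_contDiff_eventuallyEq {F : Type*} [NormedAddCommGroup F] [NormedSpace ℝ F]
    {X : E → F} {O : Set E} {u₀ : E} (hO : IsOpen O) (hu₀ : u₀ ∈ O) (hX : ContDiffOn ℝ ∞ X O) :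
    ∃ X' : E → F, ContDiff ℝ ∞ X' ∧ X' =ᶠ[𝓝 u₀] X := by
  obtain ⟨ε, hε, hball⟩ := Metric.isOpen_iff.1 hO u₀ hu₀
  let b : ContDiffBump u₀ := ⟨ε / 4, ε / 2, by positivity, by linarith⟩
  refine ⟨fun u => b u • X u, contDiff_iff_contDiffAt.2 fun u => ?_, ?_⟩
  · by_cases hu : u ∈ O
    · exact b.contDiff.contDiffAt.smul (hX.contDiffAt (hO.mem_nhds hu))
    · have hopen : (Metric.closedBall u₀ (ε / 2))ᶜ ∈ 𝓝 u :=
        Metric.isClosed_closedBall.isOpen_compl.mem_nhds fun h =>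
          hu (hball (Metric.closedBall_subset_ball (by linarith) h))
      refine (contDiffAt_const (c := (0 : F))).congr_of_eventuallyEq ?_
      filter_upwards [hopen] with v hv
      have : b v = 0 := b.zero_of_le_dist (not_le.1 fun h => hv h).le
      rw [this, zero_smul]
  · filter_upwards [b.eventuallyEq_one] with u hu
    rw [hu, Pi.one_apply, one_smul]

/-- Near a point `u₀` where it does not vanish, a smooth vector field becomes constant in suitable
coordinates `Θ`, which can be chosen tangent to the identity at `u₀`. The inverse of `Θ` is the map
`v ↦ φ (u₀ + (v - ξ v X₀), ξ v)`, with `φ` the flow, `X₀` the value of the field at `u₀` and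
`ξ` a functional with `ξ X₀ = 1`. -/
theorem exists_straightening {X : E → E} {O : Set E} {u₀ : E} (hO : IsOpen O) (hu₀ : u₀ ∈ O)
    (hX : ContDiffOn ℝ ∞ X O) (hX₀ : X u₀ ≠ 0) :
    ∃ (Θ : E → E) (W : Set E), IsOpen W ∧ u₀ ∈ W ∧ ContDiffOn ℝ ∞ Θ W ∧
      Θ u₀ = 0 ∧ HasFDerivAt Θ (ContinuousLinearMap.id ℝ E) u₀ ∧
      ∀ u ∈ W, ∃ A : E ≃L[ℝ] E, HasFDerivAt Θ (A : E →L[ℝ] E) u ∧ A (X u) = X u₀ := by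
  have : CompleteSpace E := FiniteDimensional.complete ℝ E
  obtain ⟨X', hX', hXX'⟩ := exists_contDiff_eventuallyEq hO hu₀ hX
  obtain ⟨N, hN, hNo, hu₀N⟩ := eventually_nhds_iff.1 hXX'
  obtain ⟨δ, hδ, φ, hφ, hφ0, hφd⟩ := exists_smooth_local_flow hX' u₀
  obtain ⟨ξ, hξ⟩ := SeparatingDual.exists_eq_one (R := ℝ) hX₀
  set D : Set (E × ℝ) := Metric.ball u₀ δ ×ˢ Metric.ball 0 δ with hD
  have hDo : IsOpen D := Metric.isOpen_ball.prod Metric.isOpen_ball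
  have hu₀D : (u₀, (0 : ℝ)) ∈ D := ⟨Metric.mem_ball_self hδ, Metric.mem_ball_self hδ⟩
  have hφfd : ∀ p ∈ D, HasFDerivAt φ (fderiv ℝ φ p) p := fun p hp =>
    ((hφ.contDiffAt (hDo.mem_nhds hp)).differentiableAt (by simp)).hasFDerivAt
  have htime : ∀ p ∈ D, fderiv ℝ φ p (0, 1) = X' (φ p) := by
    rintro ⟨x, s⟩ ⟨hx, hs⟩
    have h1 : HasDerivAt (fun s' : ℝ => (x, s')) ((0 : E), (1 : ℝ)) s :=
      (hasDerivAt_const s x).prodMk (hasDerivAt_id s)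
    exact ((hφfd (x, s) ⟨hx, hs⟩).comp_hasDerivAt s h1).unique (hφd x hx s hs)
  have hspace : ∀ w, fderiv ℝ φ (u₀, 0) (w, 0) = w := by
    have h1 : HasFDerivAt (fun x : E => φ (x, (0 : ℝ)))
        ((fderiv ℝ φ (u₀, 0)).comp (ContinuousLinearMap.inl ℝ E ℝ)) u₀ :=
      (hφfd _ hu₀D).comp u₀ ((hasFDerivAt_id u₀).prodMk (hasFDerivAt_const (0 : ℝ) u₀))
    have h2 : HasFDerivAt (fun x : E => φ (x, (0 : ℝ))) (ContinuousLinearMap.id ℝ E) u₀ :=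
      (hasFDerivAt_id u₀).congr_of_eventuallyEq <|
        Filter.eventuallyEq_of_mem (Metric.ball_mem_nhds u₀ hδ) hφ0
    intro w
    exact DFunLike.congr_fun (h1.unique h2) w
  let κ' : E →L[ℝ] E × ℝ :=
    (ContinuousLinearMap.id ℝ E - ξ.smulRight (X u₀)).prod ξ
  let κ : E → E × ℝ := fun v => (u₀, 0) + κ' v
  have hκ : ContDiff ℝ ∞ κ := contDiff_const.add κ'.contDiff
  have hκd : ∀ v, HasFDerivAt κ κ' v := fun v => κ'.hasFDerivAt.const_add _
  have hκ0 : κ 0 = (u₀, 0) := by simp [κ]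
  have hκX : κ' (X u₀) = (0, 1) := by simp [κ', hξ]
  let Ψ : E → E := fun v => φ (κ v)
  have hΨd : ∀ v, κ v ∈ D → HasFDerivAt Ψ ((fderiv ℝ φ (κ v)).comp κ') v := fun v hv =>
    (hφfd _ hv).comp v (hκd v)
  have hΨ0 : Ψ 0 = u₀ := by
    change φ (κ 0) = u₀
    rw [hκ0]; exact hφ0 u₀ hu₀D.1
  have hid : (fderiv ℝ φ (κ 0)).comp κ' = ContinuousLinearMap.id ℝ E := by
    ext v
    have hsplit : κ' v = (v - ξ v • X u₀, 0) + ξ v • (0, 1) := by simp [κ']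
    rw [ContinuousLinearMap.comp_apply, hsplit, map_add, map_smul, hκ0, hspace, htime _ hu₀D,
      hφ0 u₀ hu₀D.1, hXX'.eq_of_nhds]
    simp
  have hΨs : ContDiffOn ℝ ∞ Ψ (κ ⁻¹' D) := hφ.comp hκ.contDiffOn fun _ h => h
  have hopen : IsOpen (κ ⁻¹' D ∩ Ψ ⁻¹' N) :=
    hΨs.continuousOn.isOpen_inter_preimage (hDo.preimage hκ.continuous) hNo
  have hmem : (0 : E) ∈ κ ⁻¹' D ∩ Ψ ⁻¹' N :=
    ⟨by rw [Set.mem_preimage, hκ0]; exact hu₀D, by rwa [Set.mem_preimage, hΨ0]⟩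
  have hΨd0 : HasFDerivAt Ψ (ContinuousLinearEquiv.refl ℝ E : E →L[ℝ] E) 0 := by
    have := hΨd 0 hmem.1
    rwa [hid] at this
  obtain ⟨e, he0, hesub, hecoe, hesymm, heA⟩ := exists_openPartialHomeomorph_contDiffOn hopen
    hmem (hΨs.mono Set.inter_subset_left) hΨd0
  have hu₀e : u₀ ∈ e.target := by
    have := e.map_source he0
    rwa [hecoe, hΨ0] at this
  have hsymm0 : e.symm u₀ = 0 := by
    have := e.left_inv he0
    rwa [hecoe, hΨ0] at this
  refine ⟨e.symm, e.target, e.open_target, hu₀e, hesymm, hsymm0, ?_, ?_⟩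
  · have := e.hasFDerivAt_symm (f' := ContinuousLinearEquiv.refl ℝ E) hu₀e
      (by rw [hsymm0, hecoe]; exact hΨd0)
    exact this
  · intro u hu
    have hv := e.map_target hu
    obtain ⟨A, hA⟩ := heA _ hv
    refine ⟨A.symm, e.hasFDerivAt_symm hu (by rw [hecoe]; exact hA), ?_⟩
    have hΨu : Ψ (e.symm u) = u := by rw [← hecoe]; exact e.right_inv hu
    have hAX : A (X u₀) = X u := by
      have h1 := DFunLike.congr_fun (hA.unique (hΨd _ (hesub hv).1)) (X u₀)
      rw [ContinuousLinearMap.comp_apply, hκX, htime _ (hesub hv).1] at h1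
      have h2 : X' (Ψ (e.symm u)) = X (Ψ (e.symm u)) := hN _ (hesub hv).2
      rw [hΨu] at h2
      rw [← h2, ← hΨu]
      exact h1
    rw [← hAX, A.symm_apply_apply]

end Straightening

/-! ### Embedding of a pair of transverse vector fields on a vector space -/

section Local

variable {E : Type*} [NormedAddCommGroup E] [NormedSpace ℝ E] [FiniteDimensional ℝ E]

theorem exists_continuousLinearEquiv_of_linearIndependent (hE : Module.finrank ℝ E = 3) {x y : E}
    (h : LinearIndependent ℝ ![x, y]) :
    ∃ B : E ≃L[ℝ] ℝ × ℝ × ℝ, B x = (0, 0, 1) ∧ B y = (0, 1, 0) := by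
  obtain ⟨z, hz⟩ := exists_linearIndependent_cons_of_lt_finrank h (by omega)
  let b := basisOfLinearIndependentOfCardEqFinrank hz (by simp [hE])
  have hb : ∀ i, b i = (![z, x, y] : Fin 3 → E) i := fun i => by
    simp [b]
  let T : E →ₗ[ℝ] ℝ × ℝ × ℝ := (b.coord 0).prod ((b.coord 2).prod (b.coord 1))
  have hT : Function.Injective T := by
    rw [← LinearMap.ker_eq_bot, LinearMap.ker_eq_bot']
    intro v hv
    obtain ⟨h0, h2, h1⟩ : b.repr v 0 = 0 ∧ b.repr v 2 = 0 ∧ b.repr v 1 = 0 := by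
      simpa [T, Prod.ext_iff] using hv
    refine b.repr.map_eq_zero_iff.1 (Finsupp.ext fun i => ?_)
    fin_cases i <;> assumption
  refine ⟨(T.linearEquivOfInjective hT (by simp [hE])).toContinuousLinearEquiv, ?_, ?_⟩
  · have : x = b 1 := (hb 1).symm
    simp [T, this]
  · have : y = b 2 := (hb 2).symm
    simp [T, this]

/-- Two smooth vector fields on an open subset of a 3-dimensional space, linearly independent
at `u₀`, are near `u₀` the kernels of the differentials of pairs of functions `(a, b)` and `(x, y)`,
for which `(a, b, x)` is a coordinate system `Φ` and `y - a` has vanishing differential at `u₀`.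
The functions are components of straightening coordinates of the two fields. -/
theorem exists_adapted_functions (hE : Module.finrank ℝ E = 3) {X Y : E → E} {O : Set E} {u₀ : E}
    (hO : IsOpen O) (hu₀ : u₀ ∈ O) (hX : ContDiffOn ℝ ∞ X O) (hY : ContDiffOn ℝ ∞ Y O)
    (hXY : LinearIndependent ℝ ![X u₀, Y u₀]) :
    ∃ (Φ : OpenPartialHomeomorph E (ℝ × ℝ × ℝ)) (g : E → Ambient) (φ : ℝ × ℝ × ℝ → ℝ),
      u₀ ∈ Φ.source ∧ Φ.source ⊆ O ∧ ContDiffOn ℝ ∞ g Φ.source ∧ ContDiffOn ℝ ∞ φ Φ.target ∧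
      (∀ u, Φ u = ((g u).2.1, (g u).2.2, (g u).1.1)) ∧
      (∀ u ∈ Φ.source, (g u).1.2 = (g u).2.1 + φ (Φ u)) ∧
      g u₀ = 0 ∧ fderiv ℝ φ 0 = 0 ∧
      ∀ u ∈ Φ.source, ∀ v, ((fderiv ℝ g u v).2 = 0 ↔ v ∈ Submodule.span ℝ {X u}) ∧
        ((fderiv ℝ g u v).1 = 0 ↔ v ∈ Submodule.span ℝ {Y u}) := by
  have : CompleteSpace E := FiniteDimensional.complete ℝ E
  obtain ⟨B, hBX, hBY⟩ := exists_continuousLinearEquiv_of_linearIndependent hE hXY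
  obtain ⟨Θ, W, hWo, hu₀W, hΘ, hΘ0, hΘd0, hΘd⟩ :=
    exists_straightening hO hu₀ hX (hXY.ne_zero 0)
  obtain ⟨Ξ, W', hWo', hu₀W', hΞ, hΞ0, hΞd0, hΞd⟩ :=
    exists_straightening hO hu₀ hY (hXY.ne_zero 1)
  -- `(a, b) = ℓX` of the coordinates straightening `X`, `(x, y) = ℓY` of those straightening `Y`;
  -- the first component of `B` serves for both `a` and `y`, so that `d(y - a) = 0` at `u₀`
  let ℓX : ℝ × ℝ × ℝ →L[ℝ] ℝ × ℝ :=
    (ContinuousLinearMap.fst ℝ ℝ (ℝ × ℝ)).prod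
      ((ContinuousLinearMap.fst ℝ ℝ ℝ).comp (ContinuousLinearMap.snd ℝ ℝ (ℝ × ℝ)))
  let ℓY : ℝ × ℝ × ℝ →L[ℝ] ℝ × ℝ :=
    ((ContinuousLinearMap.snd ℝ ℝ ℝ).comp (ContinuousLinearMap.snd ℝ ℝ (ℝ × ℝ))).prod
      (ContinuousLinearMap.fst ℝ ℝ (ℝ × ℝ))
  let g : E → Ambient := fun u => (ℓY (B (Ξ u)), ℓX (B (Θ u)))
  -- `π = (a, b, x)` and `ρ = y - a`
  let π : Ambient →L[ℝ] ℝ × ℝ × ℝ :=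
    ((ContinuousLinearMap.fst ℝ ℝ ℝ).comp (ContinuousLinearMap.snd ℝ (ℝ × ℝ) (ℝ × ℝ))).prod
      (((ContinuousLinearMap.snd ℝ ℝ ℝ).comp (ContinuousLinearMap.snd ℝ (ℝ × ℝ) (ℝ × ℝ))).prod
        ((ContinuousLinearMap.fst ℝ ℝ ℝ).comp (ContinuousLinearMap.fst ℝ (ℝ × ℝ) (ℝ × ℝ))))
  let ρ : Ambient →L[ℝ] ℝ :=
    (ContinuousLinearMap.snd ℝ ℝ ℝ).comp (ContinuousLinearMap.fst ℝ (ℝ × ℝ) (ℝ × ℝ)) -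
      (ContinuousLinearMap.fst ℝ ℝ ℝ).comp (ContinuousLinearMap.snd ℝ (ℝ × ℝ) (ℝ × ℝ))
  have hgd : ∀ u A A', HasFDerivAt Θ A u → HasFDerivAt Ξ A' u → HasFDerivAt g
      ((ℓY.comp ((B : E →L[ℝ] ℝ × ℝ × ℝ).comp A')).prod
        (ℓX.comp ((B : E →L[ℝ] ℝ × ℝ × ℝ).comp A))) u := fun u A A' hA hA' =>
    (ℓY.hasFDerivAt.comp u (B.hasFDerivAt.comp u hA')).prodMk
      (ℓX.hasFDerivAt.comp u (B.hasFDerivAt.comp u hA))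
  have hgs : ContDiffOn ℝ ∞ g (O ∩ W ∩ W') :=
    (ℓY.contDiff.comp_contDiffOn (B.contDiff.comp_contDiffOn
      (hΞ.mono Set.inter_subset_right))).prodMk
    (ℓX.contDiff.comp_contDiffOn (B.contDiff.comp_contDiffOn
      (hΘ.mono fun _ h => h.1.2)))
  have hgd0 := hgd u₀ _ _ hΘd0 hΞd0
  have hΦd : HasFDerivAt (fun u => π (g u)) (B : E →L[ℝ] ℝ × ℝ × ℝ) u₀ := by
    refine (π.hasFDerivAt.comp u₀ hgd0).congr_fderiv ?_
    ext v <;> rfl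
  have hg0 : g u₀ = 0 := by simp [g, hΘ0, hΞ0]
  obtain ⟨Φ, hΦ0, hΦsub, hΦcoe, hΦsymm, -⟩ := exists_openPartialHomeomorph_contDiffOn
    ((hO.inter hWo).inter hWo') ⟨⟨hu₀, hu₀W⟩, hu₀W'⟩ (π.contDiff.comp_contDiffOn hgs) hΦd
  have hΦu₀ : Φ u₀ = 0 := by rw [hΦcoe, Function.comp_apply, hg0, map_zero]
  have h0tgt : (0 : ℝ × ℝ × ℝ) ∈ Φ.target := hΦu₀ ▸ Φ.map_source hΦ0
  have hsymm0 : Φ.symm 0 = u₀ := by rw [← hΦu₀]; exact Φ.left_inv hΦ0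
  refine ⟨Φ, g, fun w => ρ (g (Φ.symm w)), hΦ0, fun u hu => (hΦsub hu).1.1, hgs.mono hΦsub,
    ?_, ?_, ?_, hg0, ?_, ?_⟩
  · exact ρ.contDiff.comp_contDiffOn (hgs.comp hΦsymm fun w hw => hΦsub (Φ.map_target hw))
  · intro u; rw [hΦcoe]; rfl
  · intro u hu
    change (g u).1.2 = (g u).2.1 + ρ (g (Φ.symm (Φ u)))
    rw [Φ.left_inv hu]
    change _ = (g u).2.1 + ((g u).1.2 - (g u).2.1)
    ring
  · have h1 : HasFDerivAt Φ.symm (B.symm : ℝ × ℝ × ℝ →L[ℝ] E) 0 :=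
      Φ.hasFDerivAt_symm h0tgt (by rw [hsymm0, hΦcoe]; exact hΦd)
    have h2 := ρ.hasFDerivAt.comp (0 : ℝ × ℝ × ℝ) ((hsymm0.symm ▸ hgd0).comp (0 : ℝ × ℝ × ℝ) h1)
    exact (h2.congr_fderiv (ContinuousLinearMap.ext fun v => sub_self _)).fderiv
  · intro u hu v
    obtain ⟨A, hA, hAX⟩ := hΘd u (hΦsub hu).1.2
    obtain ⟨A', hA', hAY⟩ := hΞd u (hΦsub hu).2
    rw [(hgd u _ _ hA hA').fderiv]
    simp only [Submodule.mem_span_singleton]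
    constructor
    · change ℓX (B (A v)) = 0 ↔ _
      constructor
      · intro h
        have h' : (B (A v)).1 = 0 ∧ (B (A v)).2.1 = 0 := Prod.ext_iff.1 h
        refine ⟨(B (A v)).2.2, A.injective (B.injective ?_)⟩
        rw [map_smul, map_smul, hAX, hBX]
        refine Prod.ext ?_ (Prod.ext ?_ ?_)
        · simpa using h'.1.symm
        · simpa using h'.2.symm
        · simp
      · rintro ⟨c, rfl⟩
        rw [map_smul, map_smul, hAX, hBX]
        simp [ℓX]
    · change ℓY (B (A' v)) = 0 ↔ _
      constructor
      · intro h
        have h' : (B (A' v)).2.2 = 0 ∧ (B (A' v)).1 = 0 := Prod.ext_iff.1 h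
        refine ⟨(B (A' v)).2.1, A'.injective (B.injective ?_)⟩
        rw [map_smul, map_smul, hAY, hBY]
        refine Prod.ext ?_ (Prod.ext ?_ ?_)
        · simpa using h'.2.symm
        · simp
        · simpa using h'.1.symm
      · rintro ⟨c, rfl⟩
        rw [map_smul, map_smul, hAY, hBY]
        simp [ℓY]

end Local

/-! ### Passage to manifolds -/

/-- If the kernels of the two components of `L` are the submodules `P`, `Q`, with zero
intersection, then `L` is injective and sends them to the intersections of its range with the
factors. -/
theorem injective_and_map_eq_of_ker_components {T : Type*} [AddCommGroup T] [Module ℝ T]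
    (L : T →ₗ[ℝ] Ambient) {P Q : Submodule ℝ T} (hP : ∀ v, (L v).2 = 0 ↔ v ∈ P)
    (hQ : ∀ v, (L v).1 = 0 ↔ v ∈ Q) (h : P ⊓ Q = ⊥) :
    Function.Injective L ∧ P.map L = LinearMap.range L ⊓ tangentXY ∧
      Q.map L = LinearMap.range L ⊓ tangentAB := by
  refine ⟨?_, ?_, ?_⟩
  · rw [← LinearMap.ker_eq_bot, LinearMap.ker_eq_bot']
    intro v hv
    have : v ∈ P ⊓ Q := ⟨(hP v).1 (by rw [hv]; rfl), (hQ v).1 (by rw [hv]; rfl)⟩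
    rwa [h, Submodule.mem_bot] at this
  · ext w
    simp only [Submodule.mem_map, Submodule.mem_inf, LinearMap.mem_range, tangentXY,
      Submodule.mem_prod, Submodule.mem_top, Submodule.mem_bot, true_and]
    constructor
    · rintro ⟨v, hv, rfl⟩
      exact ⟨⟨v, rfl⟩, (hP v).2 hv⟩
    · rintro ⟨⟨v, rfl⟩, hv⟩
      exact ⟨v, (hP v).1 hv, rfl⟩
  · ext w
    simp only [Submodule.mem_map, Submodule.mem_inf, LinearMap.mem_range, tangentAB,
      Submodule.mem_prod, Submodule.mem_top, Submodule.mem_bot, and_true]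
    constructor
    · rintro ⟨v, hv, rfl⟩
      exact ⟨⟨v, rfl⟩, (hQ v).2 hv⟩
    · rintro ⟨⟨v, rfl⟩, hv⟩
      exact ⟨v, (hQ v).1 hv, rfl⟩

/-- The image of `f` is a graph `y = a + φ(a, b, x)` over the set of values of `(a, b, x)`. -/
theorem image_eq_hypersurface {S : Type*} {f : S → Ambient} {U : Set S} {V : Set (ℝ × ℝ × ℝ)}
    {φ : ℝ × ℝ × ℝ → ℝ} (hV : (fun q => ((f q).2.1, (f q).2.2, (f q).1.1)) '' U = V)
    (hφ : ∀ q ∈ U, (f q).1.2 = (f q).2.1 + φ ((f q).2.1, (f q).2.2, (f q).1.1)) :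
    f '' U = hypersurface V φ := by
  subst hV
  ext P
  constructor
  · rintro ⟨q, hq, rfl⟩
    exact ⟨_, _, _, _, rfl, ⟨q, hq, rfl⟩, hφ q hq⟩
  · rintro ⟨x, y, a, b, rfl, ⟨q, hq, hqe⟩, rfl⟩
    have h1 : (f q).2.1 = a := congrArg (fun w => w.1) hqe
    have h2 : (f q).2.2 = b := congrArg (fun w => w.2.1) hqe
    have h3 : (f q).1.1 = x := congrArg (fun w => w.2.2) hqe
    have h4 := hφ q hq
    rw [h1, h2, h3] at h4
    exact ⟨q, hq, Prod.ext (Prod.ext h3 h4) (Prod.ext h1 h2)⟩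

section

variable {M : Type*} [TopologicalSpace M] [ChartedSpace (EuclideanSpace ℝ (Fin 3)) M]
  [IsManifold (𝓡 3) ∞ M]

/-- The differential at `q` of the chart at `p`, with values in the model space itself rather than
in one of its tangent spaces. -/
noncomputable def chartDifferential (p q : M) :
    TangentSpace (𝓡 3) q →L[ℝ] EuclideanSpace ℝ (Fin 3) :=
  mfderiv (𝓡 3) 𝓘(ℝ, EuclideanSpace ℝ (Fin 3)) (extChartAt (𝓡 3) p) q

theorem chartDifferential_bijective {p q : M}
    (hq : q ∈ (chartAt (EuclideanSpace ℝ (Fin 3)) p).source) :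
    Function.Bijective (chartDifferential p q) := by
  have : IsManifold (𝓡 3) 1 M := IsManifold.of_le (n := ∞) (by simp)
  exact (isInvertible_mfderiv_extChartAt (I := 𝓡 3) (by rwa [extChartAt_source])).bijective

omit [IsManifold (𝓡 3) ∞ M] in
theorem trivializationAt_snd_eq_chartDifferential [IsManifold (𝓡 3) 1 M] {p q : M}
    (hq : q ∈ (chartAt (EuclideanSpace ℝ (Fin 3)) p).source) (v : TangentSpace (𝓡 3) q) :
    (trivializationAt (EuclideanSpace ℝ (Fin 3)) (TangentSpace (𝓡 3) : M → Type _) p ⟨q, v⟩).2 =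
      chartDifferential p q v := by
  have h := TangentBundle.continuousLinearMapAt_trivializationAt (I := 𝓡 3) hq
  have h' := Bundle.Trivialization.continuousLinearMapAt_apply_of_mem ℝ
    (trivializationAt (EuclideanSpace ℝ (Fin 3)) (TangentSpace (𝓡 3) : M → Type _) p) hq v
  exact h'.symm.trans (DFunLike.congr_fun h v)

/-- Near `p`, a direction field is read in the chart at `p` as the span of a smooth nowhere
vanishing vector field: the coordinates of a spanning field in the trivialization of the tangent
bundle at `p`, which is given by the differential of the chart. -/
theorem IsDirectionField.exists_chart_vectorField
    {D : ∀ q : M, Submodule ℝ (TangentSpace (𝓡 3) q)} (hD : IsDirectionField D) (p : M) :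
    ∃ (O : Set (EuclideanSpace ℝ (Fin 3)))
      (X : EuclideanSpace ℝ (Fin 3) → EuclideanSpace ℝ (Fin 3)),
      IsOpen O ∧ extChartAt (𝓡 3) p p ∈ O ∧ ContDiffOn ℝ ∞ X O ∧
      ∀ q ∈ (chartAt (EuclideanSpace ℝ (Fin 3)) p).source, extChartAt (𝓡 3) p q ∈ O →
        X (extChartAt (𝓡 3) p q) ≠ 0 ∧
        ∀ v, v ∈ D q ↔
          chartDifferential p q v ∈ Submodule.span ℝ {X (extChartAt (𝓡 3) p q)} := by
  have : IsManifold (𝓡 3) 1 M := IsManifold.of_le (n := ∞) (by simp)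
  obtain ⟨U, Z, hU, hpU, hZ, hDZ⟩ := hD p
  let H := EuclideanSpace ℝ (Fin 3)
  let c := chartAt H p
  let t := trivializationAt H (TangentSpace (𝓡 3) : M → Type _) p
  have hbase : t.baseSet = c.source := rfl
  let X : H → H := fun u => (t ⟨c.symm u, Z (c.symm u)⟩).2
  have hsec : ContMDiffOn (𝓡 3) 𝓘(ℝ, H) ∞ (fun q => (t ⟨q, Z q⟩).2) (U ∩ c.source) :=
    (t.contMDiffOn_section_iff (hU.inter c.open_source) (by rw [hbase]; exact fun _ h => h.2)).1
      (hZ.mono Set.inter_subset_left)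
  have hO : IsOpen (c.target ∩ c.symm ⁻¹' U) := c.symm.isOpen_inter_preimage hU
  refine ⟨c.target ∩ c.symm ⁻¹' U, X, hO, ?_, ?_, ?_⟩
  · refine ⟨mem_chart_target H p, ?_⟩
    change c.symm (c p) ∈ U
    rwa [c.left_inv (mem_chart_source H p)]
  · rw [← contMDiffOn_iff_contDiffOn]
    have hsymm : ContMDiffOn 𝓘(ℝ, H) (𝓡 3) ∞ c.symm c.target := contMDiffOn_chart_symm
    exact hsec.comp (hsymm.mono Set.inter_subset_left)
      fun u hu => ⟨hu.2, c.map_target hu.1⟩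
  · intro q hq hqO
    have hleft : c.symm (extChartAt (𝓡 3) p q) = q := c.left_inv hq
    have hqU : q ∈ U := by have := hqO.2; rwa [Set.mem_preimage, hleft] at this
    have hXq : X (extChartAt (𝓡 3) p q) = chartDifferential p q (Z q) := by
      rw [← trivializationAt_snd_eq_chartDifferential hq]
      change (t ⟨c.symm (extChartAt (𝓡 3) p q), Z (c.symm (extChartAt (𝓡 3) p q))⟩).2 = _
      rw [hleft]
    have hinj := (chartDifferential_bijective hq).injective
    obtain ⟨hZ0, hspan⟩ := hDZ q hqU
    rw [hXq]
    refine ⟨fun h => hZ0 (hinj (h.trans (map_zero _).symm)), fun v => ?_⟩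
    rw [hspan, Submodule.mem_span_singleton, Submodule.mem_span_singleton]
    refine exists_congr fun r => ?_
    rw [← hinj.eq_iff, map_smul]

end

theorem mainTheorem2 {M : Type*} [TopologicalSpace M]
    [ChartedSpace (EuclideanSpace ℝ (Fin 3)) M] [IsManifold (𝓡 3) ∞ M]
    (X Y : ∀ q : M, Submodule ℝ (TangentSpace (𝓡 3) q)) (hXY : IsParaCRStructure X Y) (p : M) :
    ∃ (U : Set M) (f : M → Ambient) (V : Set (ℝ × ℝ × ℝ)) (φ : ℝ × ℝ × ℝ → ℝ),
      IsOpen U ∧ p ∈ U ∧ IsOpen V ∧ ContDiffOn ℝ ∞ φ V ∧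
      IsSmoothEmbeddingOn f U ∧
      f '' U = hypersurface V φ ∧
      f p = 0 ∧ fderiv ℝ φ 0 (1, 0, 0) = 0 ∧
      ∀ q ∈ U,
        (X q).map (ambientDifferential f q) = imageTangent f q ⊓ tangentXY ∧
        (Y q).map (ambientDifferential f q) = imageTangent f q ⊓ tangentAB := by
  have : IsManifold (𝓡 3) 1 M := IsManifold.of_le (n := ∞) (by simp)
  let H := EuclideanSpace ℝ (Fin 3)
  let c := chartAt H p
  obtain ⟨O, X', hO, hpO, hX', hX⟩ := hXY.left.exists_chart_vectorField p
  obtain ⟨O', Y', hO', hpO', hY', hY⟩ := hXY.right.exists_chart_vectorField p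
  have hps : p ∈ c.source := mem_chart_source H p
  obtain ⟨hX0, hXp⟩ := hX p hps hpO
  obtain ⟨hY0, hYp⟩ := hY p hps hpO'
  have hli : LinearIndependent ℝ ![X' (extChartAt (𝓡 3) p p), Y' (extChartAt (𝓡 3) p p)] := by
    rw [LinearIndependent.pair_iff' hX0]
    intro a ha
    obtain ⟨v, hv⟩ := (chartDifferential_bijective hps).surjective (Y' (extChartAt (𝓡 3) p p))
    have hvX : v ∈ X p := (hXp v).2 (by
      rw [hv, ← ha]; exact Submodule.smul_mem _ _ (Submodule.mem_span_singleton_self _))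
    have hvY : v ∈ Y p := (hYp v).2 (by
      rw [hv]; exact Submodule.mem_span_singleton_self _)
    have hv0 : v ∈ X p ⊓ Y p := ⟨hvX, hvY⟩
    rw [hXY.independent p, Submodule.mem_bot] at hv0
    rw [hv0] at hv
    exact hY0 (hv.symm.trans (map_zero _))
  obtain ⟨Φ, g, φ, hpΦ, hΦO, hg, hφ, hΦg, hgφ, hg0, hφ0, hker⟩ :=
    exists_adapted_functions (by simp) (hO.inter hO') ⟨hpO, hpO'⟩
      (hX'.mono Set.inter_subset_left) (hY'.mono Set.inter_subset_right) hli
  let f : M → Ambient := fun q => g (extChartAt (𝓡 3) p q)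
  have hΨf : ∀ q, (c.trans Φ) q = ((f q).2.1, (f q).2.2, (f q).1.1) := fun q => hΦg _
  have hsource : ∀ q, q ∈ (c.trans Φ).source ↔
      q ∈ c.source ∧ extChartAt (𝓡 3) p q ∈ Φ.source := fun q => by
    rw [OpenPartialHomeomorph.trans_source]; rfl
  have hcsm : ContMDiffOn (𝓡 3) 𝓘(ℝ, H) ∞ (extChartAt (𝓡 3) p) c.source := contMDiffOn_extChartAt
  have hdf : ∀ q ∈ (c.trans Φ).source, ambientDifferential f q =
      ((fderiv ℝ g (extChartAt (𝓡 3) p q)).comp (chartDifferential p q)).toLinearMap := by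
    intro q hq
    obtain ⟨hqc, hqΦ⟩ := (hsource q).1 hq
    have h1 : MDifferentiableAt 𝓘(ℝ, H) 𝓘(ℝ, Ambient) g (extChartAt (𝓡 3) p q) :=
      ((hg.contDiffAt (Φ.open_source.mem_nhds hqΦ)).differentiableAt
        (by simp)).mdifferentiableAt
    have h2 : MDifferentiableAt (𝓡 3) 𝓘(ℝ, H) (extChartAt (𝓡 3) p) q :=
      mdifferentiableAt_extChartAt hqc
    have h3 := mfderiv_comp q h1 h2
    rw [mfderiv_eq_fderiv] at h3
    exact congrArg (fun L => ContinuousLinearMap.toLinearMap L) h3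
  -- in the chart the kernels of the components of `df` are spanned by `X'` and `Y'`
  have hlin := fun q (hq : q ∈ (c.trans Φ).source) => injective_and_map_eq_of_ker_components
    (ambientDifferential f q) (P := X q) (Q := Y q)
    (fun v => by
      rw [hdf q hq, (hX q ((hsource q).1 hq).1 (hΦO ((hsource q).1 hq).2).1).2 v]
      exact (hker _ ((hsource q).1 hq).2 _).1)
    (fun v => by
      rw [hdf q hq, (hY q ((hsource q).1 hq).1 (hΦO ((hsource q).1 hq).2).2).2 v]
      exact (hker _ ((hsource q).1 hq).2 _).2)
    (hXY.independent q)
  have hfsm : ContMDiffOn (𝓡 3) 𝓘(ℝ, Ambient) ∞ f (c.trans Φ).source :=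
    (contMDiffOn_iff_contDiffOn.2 hg).comp (hcsm.mono fun q hq => ((hsource q).1 hq).1)
      fun q hq => ((hsource q).1 hq).2
  refine ⟨(c.trans Φ).source, f, (c.trans Φ).target, φ, (c.trans Φ).open_source,
    (hsource p).2 ⟨hps, hpΦ⟩, (c.trans Φ).open_target, ?_, ⟨hfsm, fun q hq => (hlin q hq).1, ?_⟩,
    ?_, hg0, by rw [hφ0]; rfl, fun q hq => (hlin q hq).2⟩
  · exact hφ.mono fun w hw => by
      rw [OpenPartialHomeomorph.trans_target] at hw; exact hw.1
  · -- the coordinates `(a, b, x)` of `f` already embed the domain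
    have hπ : Continuous fun P : Ambient => (P.2.1, P.2.2, P.1.1) := by fun_prop
    refine Topology.IsEmbedding.of_comp (g := fun P : Ambient => (P.2.1, P.2.2, P.1.1))
      (continuousOn_iff_continuous_domRestrict.1 hfsm.continuousOn) hπ ?_
    convert (c.trans Φ).isOpenEmbedding_restrict.isEmbedding using 1
    funext q
    exact (hΨf q).symm
  · refine image_eq_hypersurface ?_ fun q hq => ?_
    · rw [← (c.trans Φ).image_source_eq_target]
      exact Set.image_congr fun q _ => (hΨf q).symm
    · rw [← hΨf]
      exact hgφ _ ((hsource q).1 hq).2
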